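/- Let $X\subset\mathbb{R}^n$ be open and let $f=(f^1,\dots,f^n)\colon X\to\mathbb{R}^n$ be a $C^1$ vector field. Suppose the system of ODEs $\dot x=f(x)$ is cooperative, i.e. $\frac{\partial f^i}{\partial x^j}(x)\ge 0$ for all $i\ne j$ and $x\in X$, and irreducible, i.e. for each $x\in X$ the matrix $A=\left[\frac{\partial f^i}{\partial x^j}(x)\right]$ is irreducible (there is no nonempty proper subset $S\subset\{1,\dots,n\}$ with $A_{ij}=0$ for all $i\in S$, $j\notin S$). Let $t\mapsto\phi_t x$ denote the nonextendible solution of the system in $X$ with $\phi_0x=x$, defined on the open interval $(\sigma(x),\tau(x))\ni 0$. Suppose there is a $C^1$ function $H\colon X\to\mathbb{R}$ which is constant on the orbits of the system (a first integral) and whose gradient is positive, i.e. $\frac{\partial H}{\partial x^i}(x)>0$ for all $i$ and all $x\in X$. For $x\in X$ let $\omega(x)$ (respectively $\alpha(x)$) be the set of all $y\in X$ for which there is a sequence $t_k\to\infty$ (respectively $t_k\to-\infty$) in $(\sigma(x),\tau(x))$ with $\phi_{t_k}x\to y$. Then: (i) for each $x\in X$, the set $\omega(x)$ is either a singleton or empty;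 (ii) for each $x\in X$, if $\alpha(x)$ is nonempty, then $x$ is an equilibrium, i.e. $\phi_t x=x$ for all $t\in\mathbb{R}$ (equivalently, $f(x)=0$). -/

import Mathlib

open Set Filter Topology

namespace CooperativeODE

/-- `x' = f(x)` on the set `X`: the curve `γ` is a solution on the open interval `J`, which
contains `0`, with initial condition `γ 0 = x`. The values of `γ` outside `J` are irrelevant. -/
structure IsSolution {n : ℕ} (f : EuclideanSpace ℝ (Fin n) → EuclideanSpace ℝ (Fin n))
    (X : Set (EuclideanSpace ℝ (Fin n))) (x : EuclideanSpace ℝ (Fin n))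
    (J : Set ℝ) (γ : ℝ → EuclideanSpace ℝ (Fin n)) : Prop where
  isOpen : IsOpen J
  ordConnected : J.OrdConnected
  zero_mem : (0 : ℝ) ∈ J
  initial : γ 0 = x
  mem : ∀ t ∈ J, γ t ∈ X
  hasDerivAt : ∀ t ∈ J, HasDerivAt γ (f (γ t)) t

/-- `γ` on `J` is the trajectory of `x`, that is, the nonextendible solution with initial
condition `γ 0 = x`: no solution on a strictly larger open interval extends it. -/
def IsTrajectory {n : ℕ} (f : EuclideanSpace ℝ (Fin n) → EuclideanSpace ℝ (Fin n))
    (X : Set (EuclideanSpace ℝ (Fin n))) (x : EuclideanSpace ℝ (Fin n))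
    (J : Set ℝ) (γ : ℝ → EuclideanSpace ℝ (Fin n)) : Prop :=
  IsSolution f X x J γ ∧
    ∀ (J' : Set ℝ) (γ' : ℝ → EuclideanSpace ℝ (Fin n)),
      IsSolution f X x J' γ' → J ⊆ J' → EqOn γ γ' J → J' = J

/-- `x` is an equilibrium: its trajectory is defined on all of `ℝ` and stays at `x`. -/
def IsEquilibrium {n : ℕ} (f : EuclideanSpace ℝ (Fin n) → EuclideanSpace ℝ (Fin n))
    (X : Set (EuclideanSpace ℝ (Fin n))) (x : EuclideanSpace ℝ (Fin n)) : Prop :=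
  IsTrajectory f X x univ (fun _ => x)

/-- The equilibria are the zeros of the vector field in `X`. -/
theorem isEquilibrium_iff {n : ℕ}
    (f : EuclideanSpace ℝ (Fin n) → EuclideanSpace ℝ (Fin n))
    (X : Set (EuclideanSpace ℝ (Fin n))) (x : EuclideanSpace ℝ (Fin n)) :
    IsEquilibrium f X x ↔ x ∈ X ∧ f x = 0 := by
  constructor
  · rintro ⟨h, -⟩
    exact ⟨h.mem 0 (mem_univ 0),
      (h.hasDerivAt 0 (mem_univ 0)).unique (hasDerivAt_const (0 : ℝ) x)⟩
  · rintro ⟨hx, hf⟩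
    refine ⟨⟨isOpen_univ, ordConnected_univ, mem_univ 0, rfl, fun _ _ => hx, fun t _ => ?_⟩,
      fun J' γ' _ hJ _ => univ_subset_iff.mp hJ⟩
    rw [hf]
    exact hasDerivAt_const t x

/-- The `ω`-limit set of `x`: the points `y ∈ X` that are limits of `φ_{t_k} x` for some
sequence of times `t_k → ∞` in the domain of the trajectory of `x`. -/
def omegaLimitSet {n : ℕ} (f : EuclideanSpace ℝ (Fin n) → EuclideanSpace ℝ (Fin n))
    (X : Set (EuclideanSpace ℝ (Fin n))) (x : EuclideanSpace ℝ (Fin n)) :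
    Set (EuclideanSpace ℝ (Fin n)) :=
  {y | y ∈ X ∧ ∃ (J : Set ℝ) (γ : ℝ → EuclideanSpace ℝ (Fin n)), IsTrajectory f X x J γ ∧
    ∃ t : ℕ → ℝ, (∀ k, t k ∈ J) ∧ Tendsto t atTop atTop ∧
      Tendsto (fun k => γ (t k)) atTop (𝓝 y)}

/-- The `α`-limit set of `x`: as the `ω`-limit set, with `t_k → -∞`. -/
def alphaLimitSet {n : ℕ} (f : EuclideanSpace ℝ (Fin n) → EuclideanSpace ℝ (Fin n))
    (X : Set (EuclideanSpace ℝ (Fin n))) (x : EuclideanSpace ℝ (Fin n)) :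
    Set (EuclideanSpace ℝ (Fin n)) :=
  {y | y ∈ X ∧ ∃ (J : Set ℝ) (γ : ℝ → EuclideanSpace ℝ (Fin n)), IsTrajectory f X x J γ ∧
    ∃ t : ℕ → ℝ, (∀ k, t k ∈ J) ∧ Tendsto t atTop atBot ∧
      Tendsto (fun k => γ (t k)) atTop (𝓝 y)}

/-- The Jacobian matrix `[∂f^i/∂x^j (x)]`. -/
noncomputable def jacobian {n : ℕ}
    (f : EuclideanSpace ℝ (Fin n) → EuclideanSpace ℝ (Fin n))
    (x : EuclideanSpace ℝ (Fin n)) : Matrix (Fin n) (Fin n) ℝ :=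
  Matrix.of fun i j => fderiv ℝ (fun y => f y i) x (EuclideanSpace.single j 1)

/-- Irreducibility of a square matrix with entries of any sign: the index set has no proper
nonempty subset `S` with `A i j = 0` for all `i ∈ S`, `j ∉ S`. -/
def MatrixIrreducible {n : ℕ} (A : Matrix (Fin n) (Fin n) ℝ) : Prop :=
  ∀ S : Set (Fin n), S.Nonempty → S ≠ univ → ∃ i ∈ S, ∃ j ∉ S, A i j ≠ 0

/-- `x' = f(x)` is a cooperative system on `X`. -/
def IsCooperative {n : ℕ} (f : EuclideanSpace ℝ (Fin n) → EuclideanSpace ℝ (Fin n))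
    (X : Set (EuclideanSpace ℝ (Fin n))) : Prop :=
  ∀ x ∈ X, ∀ i j : Fin n, i ≠ j → 0 ≤ jacobian f x i j

/-- `x' = f(x)` is a cooperative irreducible system on `X`. -/
def IsCooperativeIrreducible {n : ℕ}
    (f : EuclideanSpace ℝ (Fin n) → EuclideanSpace ℝ (Fin n))
    (X : Set (EuclideanSpace ℝ (Fin n))) : Prop :=
  IsCooperative f X ∧ ∀ x ∈ X, MatrixIrreducible (jacobian f x)

/-- `H` is a first integral on `X`: continuous on `X` and constant on orbits. -/
def IsFirstIntegral {n : ℕ} (f : EuclideanSpace ℝ (Fin n) → EuclideanSpace ℝ (Fin n))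
    (X : Set (EuclideanSpace ℝ (Fin n))) (H : EuclideanSpace ℝ (Fin n) → ℝ) : Prop :=
  ContinuousOn H X ∧
    ∀ x ∈ X, ∀ (J : Set ℝ) (γ : ℝ → EuclideanSpace ℝ (Fin n)), IsTrajectory f X x J γ →
      ∀ t ∈ J, H (γ t) = H x

/-- All coordinates of the gradient of `H` are positive at every point of `X`. -/
def HasPositiveGradient {n : ℕ} (X : Set (EuclideanSpace ℝ (Fin n)))
    (H : EuclideanSpace ℝ (Fin n) → ℝ) : Prop :=
  ∀ x ∈ X, ∀ i : Fin n, 0 < gradient H x i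

end CooperativeODE

/-!
Along a solution the weighted velocity `w i = ∂H/∂x^i * f^i` obeys the mass exchange law
`dw i/dt = ∑ j, (B i j * f^j - B j i * f^i)` with `B i j = ∂H/∂x^i * ∂f^i/∂x^j`, because the
derivative of `H` along `f` vanishes identically. The off-diagonal entries of `B` are nonnegative,
so `∑ i, |w i|` does not increase. Since `∑ i, w i = 0`, a nonzero `w` has entries of both signs,
and irreducibility then makes some mass cancel: `∑ i, |w i|` is constant only along an equilibrium.
By LaSalle's invariance principle all limit points are equilibria; for an `α`-limit point this says
that `∑ i, |w i|` tends to `0` backwards in time, so it vanishes at `x` already.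

An equilibrium `p` is Lyapunov stable. By cooperativity the right derivative of `γ ⊔ p` is at most
`f (γ ⊔ p)`, so `H (γ ⊔ p)` does not increase along a solution `γ` near `p`, and hence neither does
`(H (γ ⊔ p) - H γ) + (H (γ ⊔ p) - H p)`, which is positive away from `p`. A stable `ω`-limit point
attracts the whole solution.
-/

namespace CooperativeODE

section RealAnalysis

variable {J : Set ℝ} {g u v : ℝ → ℝ} {u' v' t a b r : ℝ}

theorem exists_hasDerivWithinAt_max (hu : HasDerivWithinAt u u' (Ici t) t)
    (hv : HasDerivWithinAt v v' (Ici t) t) :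
    ∃ d, HasDerivWithinAt (fun s => max (u s) (v s)) d (Ici t) t ∧
      (d = u' ∧ v t ≤ u t ∨ d = v' ∧ u t ≤ v t) := by
  rcases lt_trichotomy (u t) (v t) with hlt | heq | hlt
  · refine ⟨v', hv.congr_of_eventuallyEq ?_ (max_eq_right hlt.le), .inr ⟨rfl, hlt.le⟩⟩
    filter_upwards [hu.continuousWithinAt.eventually_lt hv.continuousWithinAt hlt] with s hs
      using max_eq_right hs.le
  · refine ⟨max u' v', ?_, ?_⟩
    · rw [← hasDerivWithinAt_Ioi_iff_Ici, hasDerivWithinAt_iff_tendsto_slope' self_notMem_Ioi]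
        at hu hv ⊢
      refine (hu.max hv).congr' ?_
      filter_upwards [self_mem_nhdsWithin] with s hs
      have hpos : 0 ≤ (s - t)⁻¹ := inv_nonneg.2 (sub_nonneg.2 hs.le)
      simp only [slope, vsub_eq_sub, smul_eq_mul, ← heq, max_self]
      rw [← mul_max_of_nonneg _ _ hpos, max_sub_sub_right]
    · rcases max_choice u' v' with h | h
      · exact .inl ⟨h, heq.ge⟩
      · exact .inr ⟨h, heq.le⟩
  · refine ⟨u', hu.congr_of_eventuallyEq ?_ (max_eq_left hlt.le), .inl ⟨rfl, hlt.le⟩⟩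
    filter_upwards [hv.continuousWithinAt.eventually_lt hu.continuousWithinAt hlt] with s hs
      using max_eq_left hs.le

theorem exists_hasDerivWithinAt_abs (hu : HasDerivWithinAt u u' (Ici t) t) :
    ∃ σ : ℝ, |σ| = 1 ∧ σ * u t = |u t| ∧
      HasDerivWithinAt (fun s => |u s|) (σ * u') (Ici t) t := by
  obtain ⟨d, hd, hdu⟩ := exists_hasDerivWithinAt_max hu hu.fun_neg
  simp only [← abs_eq_max_neg] at hd
  rcases hdu with ⟨rfl, h⟩ | ⟨rfl, h⟩
  · exact ⟨1, by simp, by rw [one_mul, abs_of_nonneg (by linarith)], by simpa using hd⟩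
  · exact ⟨-1, by simp, by rw [neg_one_mul, abs_of_nonpos (by linarith)], by simpa using hd⟩

theorem hasDerivAt_abs_add_sub_abs_sub (hu : HasDerivAt u u' t) :
    HasDerivAt (fun s => |u (t + s)| - |u (t - s)|) (2 * (SignType.sign (u t) * u')) 0 := by
  have hadd : HasDerivAt (fun s => u (t + s)) u' 0 := by
    simpa using HasDerivAt.comp_const_add t 0 (by simpa using hu)
  have hsub : HasDerivAt (fun s => u (t - s)) (-u') 0 := by
    simpa using HasDerivAt.comp_const_sub t 0 (by simpa using hu)
  by_cases h0 : u t = 0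
  · have hsum := hasDerivAt_iff_isLittleO_nhds_zero.1 (hadd.add hsub)
    simp only [Pi.add_apply, zero_add, add_zero, sub_zero, h0, add_neg_cancel, smul_zero] at hsum
    rw [hasDerivAt_iff_isLittleO_nhds_zero]
    simp only [h0, sign_zero, SignType.coe_zero, zero_mul, mul_zero, smul_zero, zero_add,
      add_zero, sub_zero, sub_self]
    refine (Asymptotics.IsBigO.of_norm_le fun s => ?_).trans_isLittleO hsum.norm_left
    simpa using abs_abs_sub_abs_le (u (t + s)) (-u (t - s))
  · have hsign : ∀ s, s = u t → HasDerivAt (|·|) (SignType.sign (u t) : ℝ) s := fun s hs =>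
      hs ▸ hasDerivAt_abs (hs ▸ h0)
    refine (((hsign _ (by simp)).comp 0 hadd).sub ((hsign _ (by simp)).comp 0 hsub)).congr_deriv ?_
    ring

theorem antitoneOn_of_right_deriv_nonpos (hJ : J.OrdConnected) (hg : ContinuousOn g J)
    (hg' : ∀ t ∈ J, ∃ d ≤ 0, HasDerivWithinAt g d (Ici t) t) : AntitoneOn g J := by
  choose! d hd hgd using hg'
  intro a ha b hb hab
  have hsub : Icc a b ⊆ J := hJ.out ha hb
  exact image_le_of_deriv_right_le_deriv_boundary (B := fun _ => g a) (B' := 0)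
    (hg.mono hsub) (fun t ht => hgd t (hsub (Ico_subset_Icc_self ht))) le_rfl continuousOn_const
    (fun t _ => hasDerivWithinAt_const t _ _)
    (fun t ht => hd t (hsub (Ico_subset_Icc_self ht))) (right_mem_Icc.2 hab)

theorem exists_eq_and_forall_le_of_lt_of_le (hab : a ≤ b)
    (hg : ContinuousOn g (Icc a b)) (ha : g a < r) (hb : r ≤ g b) :
    ∃ c ∈ Icc a b, g c = r ∧ ∀ s ∈ Icc a c, g s ≤ r := by
  have hcompact : IsCompact (Icc a b ∩ g ⁻¹' {r}) :=
    isCompact_Icc.of_isClosed_subset (hg.preimage_isClosed_of_isClosed isClosed_Icc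
      isClosed_singleton) inter_subset_left
  obtain ⟨c, ⟨hc, hcr⟩, hleast⟩ := hcompact.exists_isLeast
    (intermediate_value_Icc hab hg ⟨ha.le, hb⟩)
  refine ⟨c, hc, hcr, fun s hs => le_of_not_gt fun hlt => ?_⟩
  obtain ⟨s', hs', hs'r⟩ := intermediate_value_Icc hs.1
    (hg.mono (Icc_subset_Icc_right (hs.2.trans hc.2))) ⟨ha.le, hlt.le⟩
  have hcs' : c ≤ s' := hleast ⟨⟨hs'.1, hs'.2.trans (hs.2.trans hc.2)⟩, hs'r⟩
  have hsc : s = c := hs.2.antisymm (hcs'.trans hs'.2)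
  exact hlt.ne' (hsc ▸ hcr)

end RealAnalysis

section MonotoneLimits

variable {α β : Type*} [LinearOrder α] [LinearOrder β] [TopologicalSpace β] [OrderTopology β]
  {J : Set α} {g : α → β} {c : β} {τ : ℕ → α}

theorem eventually_atTop_mem_of_tendsto (hJ : J.OrdConnected) (hτJ : ∀ k, τ k ∈ J)
    (hτ : Tendsto τ atTop atTop) : ∀ᶠ t in atTop, t ∈ J := by
  filter_upwards [eventually_ge_atTop (τ 0)] with t ht
  obtain ⟨k, hk⟩ := (hτ.eventually_ge_atTop t).exists
  exact hJ.out (hτJ 0) (hτJ k) ⟨ht, hk⟩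

theorem eventually_atBot_mem_of_tendsto (hJ : J.OrdConnected) (hτJ : ∀ k, τ k ∈ J)
    (hτ : Tendsto τ atTop atBot) : ∀ᶠ t in atBot, t ∈ J :=
  eventually_atTop_mem_of_tendsto (α := αᵒᵈ) hJ.dual hτJ hτ

theorem tendsto_atTop_of_antitoneOn (hJ : J.OrdConnected) (hg : AntitoneOn g J)
    (hτJ : ∀ k, τ k ∈ J) (hτ : Tendsto τ atTop atTop)
    (hgτ : Tendsto (fun k => g (τ k)) atTop (𝓝 c)) : Tendsto g atTop (𝓝 c) := by
  have hmem := eventually_atTop_mem_of_tendsto hJ hτJ hτ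
  refine tendsto_order.2 ⟨fun a ha => ?_, fun b hb => ?_⟩
  · filter_upwards [hmem] with t ht
    refine ha.trans_le (le_of_tendsto hgτ ?_)
    filter_upwards [hτ.eventually_ge_atTop t] with k hk using hg ht (hτJ k) hk
  · obtain ⟨k, hk⟩ := (hgτ.eventually_lt_const hb).exists
    filter_upwards [hmem, eventually_ge_atTop (τ k)] with t ht hkt
      using (hg (hτJ k) ht hkt).trans_lt hk

theorem tendsto_atBot_of_antitoneOn (hJ : J.OrdConnected) (hg : AntitoneOn g J)
    (hτJ : ∀ k, τ k ∈ J) (hτ : Tendsto τ atTop atBot)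
    (hgτ : Tendsto (fun k => g (τ k)) atTop (𝓝 c)) : Tendsto g atBot (𝓝 c) :=
  tendsto_atTop_of_antitoneOn (α := αᵒᵈ) (β := βᵒᵈ) hJ.dual hg.dual hτJ hτ hgτ

end MonotoneLimits

section NetFlux

variable {ι : Type*} {B : Matrix ι ι ℝ} {v σ : ι → ℝ}

theorem abs_sign_le_one (a : ℝ) : |(SignType.sign a : ℝ)| ≤ 1 := by
  cases SignType.sign a <;> simp

theorem mul_sub_abs_nonpos (hB : ∀ i j, i ≠ j → 0 ≤ B i j) (hσ₁ : ∀ i, |σ i| ≤ 1)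
    (hσ : ∀ i, σ i * v i = |v i|) (i j : ι) : B i j * (σ i * v j - |v j|) ≤ 0 := by
  rcases eq_or_ne i j with rfl | hij
  · rw [hσ, sub_self, mul_zero]
  · refine mul_nonpos_of_nonneg_of_nonpos (hB i j hij) (sub_nonpos.2 ?_)
    calc σ i * v j ≤ |σ i| * |v j| := (le_abs_self _).trans (abs_mul _ _).le
      _ ≤ |v j| := mul_le_of_le_one_left (abs_nonneg _) (hσ₁ i)

variable [Fintype ι]

/-- The net rate `∑ j, (B i j * v j - B j i * v i)` at which the site `i` gains mass when mass
passes from `j` to `i` at the rate `B i j * v j`. It does not depend on the diagonal of `B`. -/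
def netFlux (B : Matrix ι ι ℝ) (v : ι → ℝ) (i : ι) : ℝ :=
  ∑ j, (B i j * v j - B j i * v i)

theorem sum_mul_netFlux (hσ : ∀ i, σ i * v i = |v i|) :
    ∑ i, σ i * netFlux B v i = ∑ i, ∑ j, B i j * (σ i * v j - |v j|) := by
  have hswap : ∑ i, ∑ j, σ i * (B j i * v i) = ∑ i, ∑ j, σ j * (B i j * v j) :=
    Finset.sum_comm
  simp only [netFlux, Finset.mul_sum, mul_sub, Finset.sum_sub_distrib, hswap, ← hσ]
  congr 1 <;> exact Finset.sum_congr rfl fun i _ => Finset.sum_congr rfl fun j _ => by ring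

theorem sum_mul_netFlux_nonpos (hB : ∀ i j, i ≠ j → 0 ≤ B i j) (hσ₁ : ∀ i, |σ i| ≤ 1)
    (hσ : ∀ i, σ i * v i = |v i|) : ∑ i, σ i * netFlux B v i ≤ 0 := by
  rw [sum_mul_netFlux hσ]
  exact Finset.sum_nonpos fun i _ => Finset.sum_nonpos fun j _ => mul_sub_abs_nonpos hB hσ₁ hσ i j

theorem sum_sign_mul_netFlux_neg {n : ℕ} {B : Matrix (Fin n) (Fin n) ℝ} {v : Fin n → ℝ}
    (hB : ∀ i j, i ≠ j → 0 ≤ B i j) (hirr : MatrixIrreducible B) (hneg : ∃ i, v i < 0)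
    (hpos : ∃ j, 0 < v j) : ∑ i, SignType.sign (v i) * netFlux B v i < 0 := by
  have hterm := mul_sub_abs_nonpos hB (fun i => abs_sign_le_one (v i)) fun i => sign_mul_self (v i)
  obtain ⟨a, ha⟩ := hneg
  obtain ⟨b, hb⟩ := hpos
  obtain ⟨i, hi, j, hj, hij⟩ := hirr {i | v i ≤ 0} ⟨a, ha.le⟩ fun h =>
    hb.not_ge (h ▸ mem_univ b : b ∈ {i | v i ≤ 0})
  have hi : v i ≤ 0 := hi
  have hj : 0 < v j := not_le.1 hj
  have hBij : 0 < B i j := (hB i j (by rintro rfl; exact hi.not_gt hj)).lt_of_ne' hij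
  have hsign : (SignType.sign (v i) : ℝ) ≤ 0 := by
    rcases hi.lt_or_eq with h | h <;> simp [h, sign_neg]
  have hlt : B i j * (SignType.sign (v i) * v j - |v j|) < 0 :=
    mul_neg_of_pos_of_neg hBij <| sub_neg.2 <|
      (mul_nonpos_of_nonpos_of_nonneg hsign hj.le).trans_lt (abs_pos.2 hj.ne')
  rw [sum_mul_netFlux fun i => sign_mul_self (v i)]
  refine Finset.sum_neg' (fun i _ => Finset.sum_nonpos fun j _ => hterm i j)
    ⟨i, Finset.mem_univ i, Finset.sum_neg' (fun j _ => hterm i j) ⟨j, Finset.mem_univ j, hlt⟩⟩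

theorem exists_neg_and_exists_pos_of_sum_mul_eq_zero {h : ι → ℝ} (hh : ∀ i, 0 < h i)
    (hsum : ∑ i, h i * v i = 0) (hv : v ≠ 0) : (∃ i, v i < 0) ∧ ∃ j, 0 < v j := by
  obtain ⟨k, hk⟩ := Function.ne_iff.1 hv
  have hne : h k * v k ≠ 0 := mul_ne_zero (hh k).ne' hk
  constructor
  · obtain ⟨i, -, hi⟩ := Finset.exists_pos_of_sum_zero_of_exists_nonzero (fun i => -(h i * v i))
      (by rw [Finset.sum_neg_distrib, hsum, neg_zero]) ⟨k, Finset.mem_univ k, neg_ne_zero.2 hne⟩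
    exact ⟨i, neg_of_mul_neg_right (neg_pos.1 hi) (hh i).le⟩
  · obtain ⟨j, -, hj⟩ := Finset.exists_pos_of_sum_zero_of_exists_nonzero (fun i => h i * v i)
      hsum ⟨k, Finset.mem_univ k, hne⟩
    exact ⟨j, pos_of_mul_pos_right hj (hh j).le⟩

end NetFlux

section Invariance

variable {E F : Type*} [NormedAddCommGroup E] [NormedSpace ℝ E] [NormedAddCommGroup F]
  [NormedSpace ℝ F]

theorem tendsto_inv_smul_sub_of_hasStrictFDerivAt {ι : Type*} {l : Filter ι} {g : E → F}
    {g' : E →L[ℝ] F} {x : E} (hg : HasStrictFDerivAt g g' x) {u : ι → E} {ε : ι → ℝ} (e : E)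
    (hu : Tendsto u l (𝓝 x)) (hε : Tendsto ε l (𝓝[≠] 0)) :
    Tendsto (fun k => (ε k)⁻¹ • (g (u k + ε k • e) - g (u k))) l (𝓝 (g' e)) := by
  have hue : Tendsto (fun k => u k + ε k • e) l (𝓝 x) := by
    simpa using hu.add ((hε.mono_right nhdsWithin_le_nhds).smul_const e)
  have ho : (fun k => g (u k + ε k • e) - g (u k) - g' (ε k • e)) =o[l] ε := by
    have := hg.isLittleO.comp_tendsto (hue.prodMk_nhds hu)
    simp only [Function.comp_def, add_sub_cancel_left] at this
    exact this.trans_isBigO <| Asymptotics.IsBigO.of_bound ‖e‖ <| Eventually.of_forall fun k => by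
      rw [norm_smul, mul_comm]
  have h0 := ho.tendsto_inv_smul_nhds_zero.add_const (g' e)
  rw [zero_add] at h0
  refine h0.congr' ?_
  filter_upwards [hε self_mem_nhdsWithin] with k hk
  rw [map_smul, smul_sub, inv_smul_smul₀ hk, sub_add_cancel]

theorem tendsto_clm_apply {ι : Type*} {l : Filter ι} {L : ι → E →L[ℝ] F} {L₀ : E →L[ℝ] F}
    {u : ι → E} {u₀ : E} (hL : Tendsto L l (𝓝 L₀)) (hu : Tendsto u l (𝓝 u₀)) :
    Tendsto (fun k => L k (u k)) l (𝓝 (L₀ u₀)) :=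
  (isBoundedBilinearMap_apply.continuous.tendsto (L₀, u₀)).comp (hL.prodMk_nhds hu)

variable {X : Set E} {f : E → E} {H : E → F} {γ : ℝ → E} {x : E} {t : ℝ}

theorem differentiableAt_of_contDiffOn (hX : IsOpen X) (hH : ContDiffOn ℝ 1 H X) (hx : x ∈ X) :
    DifferentiableAt ℝ H x :=
  (hH.contDiffAt (hX.mem_nhds hx)).differentiableAt one_ne_zero

theorem hasDerivAt_comp_of_fderiv_apply_eq_zero (hX : IsOpen X) (hH : ContDiffOn ℝ 1 H X)
    (hinv : ∀ x ∈ X, fderiv ℝ H x (f x) = 0) (hγX : γ t ∈ X) (hγ : HasDerivAt γ (f (γ t)) t) :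
    HasDerivAt (fun s => H (γ s)) 0 t := by
  rw [← hinv _ hγX]
  exact (differentiableAt_of_contDiffOn hX hH hγX).hasFDerivAt.comp_hasDerivAt t hγ

/-- `H` is only `C¹`, so `fderiv ℝ H` cannot be differentiated along `γ` by the chain rule; but the
difference quotients of `H` in the direction `e` can be, and by invariance their derivatives
converge locally uniformly. -/
theorem hasDerivAt_fderiv_apply_of_fderiv_apply_eq_zero (hX : IsOpen X) (hf : ContDiffOn ℝ 1 f X)
    (hH : ContDiffOn ℝ 1 H X) (hinv : ∀ x ∈ X, fderiv ℝ H x (f x) = 0) (hγX : γ t ∈ X)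
    (hγ : ∀ᶠ s in 𝓝 t, HasDerivAt γ (f (γ s)) s) (e : E) :
    HasDerivAt (fun s => fderiv ℝ H (γ s) e) (-fderiv ℝ H (γ t) (fderiv ℝ f (γ t) e)) t := by
  have hXt : X ∈ 𝓝 (γ t) := hX.mem_nhds hγX
  have hcont : ContinuousAt γ t := hγ.self_of_nhds.continuousAt
  have hdf := (hf.continuousOn_fderiv_of_isOpen hX le_rfl).continuousAt hXt
  have hdH := (hH.continuousOn_fderiv_of_isOpen hX le_rfl).continuousAt hXt
  have hγX' : ∀ᶠ s in 𝓝 t, γ s ∈ X := hcont hXt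
  let l : Filter (ℝ × ℝ) := 𝓝[≠] 0 ×ˢ 𝓝 t
  have hε : Tendsto Prod.fst l (𝓝[≠] 0) := tendsto_fst
  have hγ₀ : Tendsto (fun q : ℝ × ℝ => γ q.2) l (𝓝 (γ t)) := hcont.tendsto.comp tendsto_snd
  have hγ₁ : Tendsto (fun q : ℝ × ℝ => γ q.2 + q.1 • e) l (𝓝 (γ t)) := by
    simpa using hγ₀.add ((hε.mono_right nhdsWithin_le_nhds).smul_const e)
  refine hasDerivAt_of_tendstoUniformlyOnFilter (l := 𝓝[≠] (0 : ℝ))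
    (f := fun ε s => ε⁻¹ • (H (γ s + ε • e) - H (γ s)))
    (f' := fun ε s => -fderiv ℝ H (γ s + ε • e) (ε⁻¹ • (f (γ s + ε • e) - f (γ s))))
    (g' := fun s => -fderiv ℝ H (γ s) (fderiv ℝ f (γ s) e)) ?_ ?_ ?_
  · rw [tendstoUniformlyOnFilter_iff_tendsto]
    refine Tendsto.mono_right ?_ (nhds_le_uniformity (-fderiv ℝ H (γ t) (fderiv ℝ f (γ t) e)))
    have hslope := tendsto_inv_smul_sub_of_hasStrictFDerivAt
      ((hf.contDiffAt hXt).hasStrictFDerivAt one_ne_zero) e hγ₀ hε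
    exact (tendsto_clm_apply (hdH.tendsto.comp hγ₀)
        (tendsto_clm_apply (hdf.tendsto.comp hγ₀) tendsto_const_nhds)).neg.prodMk_nhds
      (tendsto_clm_apply (hdH.tendsto.comp hγ₁) hslope).neg
  · filter_upwards [tendsto_snd.eventually hγ, tendsto_snd.eventually hγX', hγ₁ hXt]
      with q hq hqX hqeX
    have hshift := (differentiableAt_of_contDiffOn hX hH hqeX).hasFDerivAt.comp_hasDerivAt q.2
      (hq.add_const (q.1 • e))
    refine ((hshift.sub (hasDerivAt_comp_of_fderiv_apply_eq_zero hX hH hinv hqX hq)).const_smul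
      q.1⁻¹).congr_deriv ?_
    rw [map_smul, map_sub, hinv _ hqeX, zero_sub, smul_neg, neg_neg, sub_zero]
  · filter_upwards [hγX'] with s hs
    exact tendsto_inv_smul_sub_of_hasStrictFDerivAt
      ((hH.contDiffAt (hX.mem_nhds hs)).hasStrictFDerivAt one_ne_zero) e tendsto_const_nhds
      tendsto_id

end Invariance

section VectorField

variable {n : ℕ} {X K : Set (EuclideanSpace ℝ (Fin n))}
  {f : EuclideanSpace ℝ (Fin n) → EuclideanSpace ℝ (Fin n)}
  {H : EuclideanSpace ℝ (Fin n) → ℝ} {x y p : EuclideanSpace ℝ (Fin n)}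
  {J J' : Set ℝ} {γ γ' Γ : ℝ → EuclideanSpace ℝ (Fin n)} {t c r : ℝ}

theorem gradient_apply (H : EuclideanSpace ℝ (Fin n) → ℝ) (x : EuclideanSpace ℝ (Fin n))
    (i : Fin n) : gradient H x i = fderiv ℝ H x (EuclideanSpace.single i 1) := by
  rw [← toDual_gradient, InnerProductSpace.toDual_apply_apply, EuclideanSpace.inner_single_right]
  simp

theorem fderiv_apply_eq_sum_gradient_mul (H : EuclideanSpace ℝ (Fin n) → ℝ)
    (x w : EuclideanSpace ℝ (Fin n)) : fderiv ℝ H x w = ∑ i, gradient H x i * w i := by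
  conv_lhs => rw [← (EuclideanSpace.basisFun (Fin n) ℝ).sum_repr w]
  simp [gradient_apply, mul_comm]

theorem jacobian_apply (hf : DifferentiableAt ℝ f x) (i j : Fin n) :
    jacobian f x i j = fderiv ℝ f x (EuclideanSpace.single j 1) i := by
  have h := (EuclideanSpace.proj i : EuclideanSpace ℝ (Fin n) →L[ℝ] ℝ).hasFDerivAt.comp x
    hf.hasFDerivAt
  exact congrArg (· (EuclideanSpace.single j 1)) h.fderiv

theorem fderiv_apply_eq_sum_jacobian_mul (hf : DifferentiableAt ℝ f x)
    (w : EuclideanSpace ℝ (Fin n)) (i : Fin n) :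
    fderiv ℝ f x w i = ∑ j, jacobian f x i j * w j := by
  conv_lhs => rw [← (EuclideanSpace.basisFun (Fin n) ℝ).sum_repr w]
  simp [jacobian_apply hf, mul_comm]

theorem continuousOn_gradient_apply (hX : IsOpen X) (hH : ContDiffOn ℝ 1 H X) (i : Fin n) :
    ContinuousOn (fun y => gradient H y i) X := by
  simp only [gradient_apply]
  exact (hH.continuousOn_fderiv_of_isOpen hX le_rfl).clm_apply continuousOn_const

/-! ### Solutions and trajectories -/

theorem IsSolution.continuousOn (h : IsSolution f X x J γ) : ContinuousOn γ J := fun t ht =>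
  (h.hasDerivAt t ht).continuousAt.continuousWithinAt

theorem IsSolution.shift (h : IsSolution f X x J γ) (ht : t ∈ J) :
    IsSolution f X (γ t) ((· + t) ⁻¹' J) (fun s => γ (s + t)) where
  isOpen := h.isOpen.preimage (by fun_prop)
  ordConnected := h.ordConnected.preimage_mono fun a b hab => by simpa using hab
  zero_mem := by simpa using ht
  initial := by simp
  mem s hs := h.mem _ hs
  hasDerivAt s hs := (h.hasDerivAt (s + t) hs).comp_add_const s t

theorem IsSolution.eventuallyEq (hX : IsOpen X) (hf : ContDiffOn ℝ 1 f X)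
    (h : IsSolution f X x J γ) (h' : IsSolution f X y J' γ') (ht : t ∈ J) (ht' : t ∈ J')
    (heq : γ t = γ' t) : γ =ᶠ[𝓝 t] γ' := by
  obtain ⟨K, s, hs, hK⟩ :=
    (hf.contDiffAt (hX.mem_nhds (h.mem t ht))).exists_lipschitzOnWith
  refine ODE_solution_unique_of_eventually (v := fun _ => f) (s := fun _ => s) (K := K)
    (Eventually.of_forall fun _ => hK) ?_ ?_ heq
  · filter_upwards [(h.hasDerivAt t ht).continuousAt hs, h.isOpen.mem_nhds ht] with u hu hu'
      using ⟨h.hasDerivAt u hu', hu⟩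
  · filter_upwards [(h'.hasDerivAt t ht').continuousAt (heq ▸ hs), h'.isOpen.mem_nhds ht']
      with u hu hu' using ⟨h'.hasDerivAt u hu', hu⟩

theorem IsSolution.eqOn (hX : IsOpen X) (hf : ContDiffOn ℝ 1 f X) (h : IsSolution f X x J γ)
    (h' : IsSolution f X x J' γ') : EqOn γ γ' (J ∩ J') := by
  have hsub : J ∩ J' ⊆ {t | γ =ᶠ[𝓝 t] γ'} := by
    refine (h.ordConnected.inter h'.ordConnected).isPreconnected.subset_of_closure_inter_subset
      isOpen_setOfPred_eventually_nhds ⟨0, ⟨h.zero_mem, h'.zero_mem⟩, h.eventuallyEq hX hf h'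
        h.zero_mem h'.zero_mem (h.initial.trans h'.initial.symm)⟩ ?_
    rintro t ⟨hcl, ht, ht'⟩
    have hfreq : ∃ᶠ s in 𝓝 t, γ s = γ' s :=
      (mem_closure_iff_frequently.1 hcl).mono fun s hs => hs.self_of_nhds
    refine h.eventuallyEq hX hf h' ht ht' (by_contra fun hne => hfreq ?_)
    exact ((h.hasDerivAt t ht).continuousAt.ne_iff_eventually_ne
      (h'.hasDerivAt t ht').continuousAt).1 hne
  exact fun t ht => (hsub ht).self_of_nhds

/-- The union of the domains of all solutions with initial condition `x`, that is, the domain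
`(σ(x), τ(x))` of the trajectory of `x`. -/
def maximalInterval (f : EuclideanSpace ℝ (Fin n) → EuclideanSpace ℝ (Fin n))
    (X : Set (EuclideanSpace ℝ (Fin n))) (x : EuclideanSpace ℝ (Fin n)) : Set ℝ :=
  ⋃₀ {J | ∃ γ, IsSolution f X x J γ}

theorem IsSolution.subset_maximalInterval (h : IsSolution f X x J γ) :
    J ⊆ maximalInterval f X x := subset_sUnion_of_mem ⟨γ, h⟩

theorem exists_forall_isSolution_eqOn (hX : IsOpen X) (hf : ContDiffOn ℝ 1 f X)
    (x : EuclideanSpace ℝ (Fin n)) :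
    ∃ Γ : ℝ → EuclideanSpace ℝ (Fin n), ∀ J γ, IsSolution f X x J γ → EqOn γ Γ J := by
  have hval : ∀ t, ∃ z, ∀ J γ, IsSolution f X x J γ → t ∈ J → γ t = z := fun t => by
    by_cases ht : ∃ J γ, IsSolution f X x J γ ∧ t ∈ J
    · obtain ⟨J, γ, h, htJ⟩ := ht
      exact ⟨γ t, fun J' γ' h' htJ' => h'.eqOn hX hf h ⟨htJ', htJ⟩⟩
    · exact ⟨0, fun J γ h htJ => (ht ⟨J, γ, h, htJ⟩).elim⟩
  choose Γ hΓ using hval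
  exact ⟨Γ, fun J γ h t ht => hΓ t J γ h ht⟩

theorem IsSolution.isSolution_maximalInterval (h : IsSolution f X x J γ)
    (hΓ : ∀ J γ, IsSolution f X x J γ → EqOn γ Γ J) :
    IsSolution f X x (maximalInterval f X x) Γ where
  isOpen := isOpen_sUnion fun _ ⟨_, h'⟩ => h'.isOpen
  ordConnected := by
    refine (isPreconnected_sUnion 0 _ ?_ ?_).ordConnected
    · exact fun _ ⟨_, h'⟩ => h'.zero_mem
    · exact fun _ ⟨_, h'⟩ => h'.ordConnected.isPreconnected
  zero_mem := h.subset_maximalInterval h.zero_mem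
  initial := (hΓ _ _ h h.zero_mem).symm.trans h.initial
  mem := by
    rintro t ⟨J', ⟨γ', h'⟩, ht⟩
    exact hΓ _ _ h' ht ▸ h'.mem t ht
  hasDerivAt := by
    rintro t ⟨J', ⟨γ', h'⟩, ht⟩
    rw [← hΓ _ _ h' ht]
    exact (h'.hasDerivAt t ht).congr_of_eventuallyEq
      ((hΓ _ _ h').symm.eventuallyEq_of_mem (h'.isOpen.mem_nhds ht))

theorem IsTrajectory.eq_maximalInterval (hX : IsOpen X) (hf : ContDiffOn ℝ 1 f X)
    (h : IsTrajectory f X x J γ) : J = maximalInterval f X x := by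
  obtain ⟨Γ, hΓ⟩ := exists_forall_isSolution_eqOn hX hf x
  exact (h.2 _ Γ (h.1.isSolution_maximalInterval hΓ) h.1.subset_maximalInterval (hΓ _ _ h.1)).symm

theorem IsTrajectory.unique (hX : IsOpen X) (hf : ContDiffOn ℝ 1 f X)
    (h : IsTrajectory f X x J γ) (h' : IsTrajectory f X x J' γ') : J = J' ∧ EqOn γ γ' J := by
  obtain rfl : J = J' := (h.eq_maximalInterval hX hf).trans (h'.eq_maximalInterval hX hf).symm
  exact ⟨rfl, inter_self J ▸ h.1.eqOn hX hf h'.1⟩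

theorem IsSolution.exists_isTrajectory (hX : IsOpen X) (hf : ContDiffOn ℝ 1 f X)
    (h : IsSolution f X x J γ) : ∃ K Γ, IsTrajectory f X x K Γ := by
  obtain ⟨Γ, hΓ⟩ := exists_forall_isSolution_eqOn hX hf x
  exact ⟨_, Γ, h.isSolution_maximalInterval hΓ,
    fun _ _ h' hsub _ => h'.subset_maximalInterval.antisymm hsub⟩

theorem exists_isSolution_continuousAt (hX : IsOpen X) (hf : ContDiffOn ℝ 1 f X) (hx : x ∈ X) :
    ∃ δ > 0, ∃ φ : EuclideanSpace ℝ (Fin n) → ℝ → EuclideanSpace ℝ (Fin n),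
      (∀ᶠ y in 𝓝 x, IsSolution f X y (Ioo (-δ) δ) (φ y)) ∧
      ∀ s ∈ Ioo (-δ) δ, ContinuousAt (fun y => φ y s) x := by
  obtain ⟨ε, hε, a, r, L, K, hr, hpl⟩ :=
    IsPicardLindelof.of_contDiffAt_one (hf.contDiffAt (hX.mem_nhds hx))
  obtain ⟨φ, hφ, hcont⟩ :=
    (hpl 0).exists_forall_mem_closedBall_eq_hasDerivWithinAt_continuousOn
  have hball : Metric.closedBall x r ∈ 𝓝 x := Metric.closedBall_mem_nhds x hr
  have hat : ∀ s ∈ Ioo (-ε) ε, ContinuousAt φ (x, s) := fun s hs =>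
    hcont.continuousAt
      (prod_mem_nhds hball (Icc_mem_nhds (by simpa using hs.1) (by simpa using hs.2)))
  have hφX : ∀ᶠ q in 𝓝 x ×ˢ 𝓝 (0 : ℝ), φ q ∈ X := by
    rw [← nhds_prod_eq]
    refine hat 0 (by simpa using hε) (hX.mem_nhds ?_)
    rwa [(hφ x (Metric.mem_closedBall_self r.2)).1]
  obtain ⟨P, hP, Q, hQ, hPQ⟩ := eventually_prod_iff.1 hφX
  obtain ⟨ρ, hρ, hρQ⟩ := Metric.eventually_nhds_iff_ball.1 hQ
  rw [Real.ball_eq_Ioo, zero_sub, zero_add] at hρQ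
  have hsub : Ioo (-min ρ ε) (min ρ ε) ⊆ Ioo (-ε) ε :=
    Ioo_subset_Ioo (neg_le_neg (min_le_right _ _)) (min_le_right _ _)
  have hsub' : Ioo (-min ρ ε) (min ρ ε) ⊆ Ioo (-ρ) ρ :=
    Ioo_subset_Ioo (neg_le_neg (min_le_left _ _)) (min_le_left _ _)
  refine ⟨min ρ ε, lt_min hρ hε, fun y t => φ (y, t), ?_, fun s hs =>
    ContinuousAt.comp (f := fun y => (y, s)) (hat s (hsub hs)) (by fun_prop)⟩
  filter_upwards [hP, hball] with y hyP hyr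
  refine ⟨isOpen_Ioo, ordConnected_Ioo, by simp [hρ, hε], (hφ y hyr).1,
    fun t ht => hPQ hyP (hρQ t (hsub' ht)), fun t ht => ?_⟩
  have ht : t ∈ Ioo (0 - ε) (0 + ε) := by simpa using hsub ht
  exact ((hφ y hyr).2 t (Ioo_subset_Icc_self ht)).hasDerivAt (Icc_mem_nhds ht.1 ht.2)

theorem IsSolution.exists_tendsto_add (hX : IsOpen X) (hf : ContDiffOn ℝ 1 f X)
    (h : IsSolution f X x J γ) (hy : y ∈ X) {τ : ℕ → ℝ} (hτ : ∀ k, τ k ∈ J)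
    (hlim : Tendsto (fun k => γ (τ k)) atTop (𝓝 y)) :
    ∃ δ > 0, ∃ β, IsSolution f X y (Ioo (-δ) δ) β ∧
      ∀ s ∈ Ioo (-δ) δ, (∀ᶠ k in atTop, s + τ k ∈ J) →
        Tendsto (fun k => γ (s + τ k)) atTop (𝓝 (β s)) := by
  obtain ⟨δ, hδ, φ, hφ, hcont⟩ := exists_isSolution_continuousAt hX hf hy
  refine ⟨δ, hδ, φ y, hφ.self_of_nhds, fun s hs hJ => ?_⟩
  refine ((hcont s hs).tendsto.comp hlim).congr' ?_
  filter_upwards [hlim.eventually hφ, hJ] with k hk hkJ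
  exact hk.eqOn hX hf (h.shift (hτ k)) ⟨hs, hkJ⟩

theorem IsFirstIntegral.fderiv_apply_eq_zero (hX : IsOpen X) (hf : ContDiffOn ℝ 1 f X)
    (hH : ContDiffOn ℝ 1 H X) (hfirst : IsFirstIntegral f X H) (hx : x ∈ X) :
    fderiv ℝ H x (f x) = 0 := by
  obtain ⟨δ, -, φ, hφ, -⟩ := exists_isSolution_continuousAt hX hf hx
  obtain ⟨K, Γ, hΓ⟩ := hφ.self_of_nhds.exists_isTrajectory hX hf
  have h0 : Γ 0 = x := hΓ.1.initial
  have hderiv : HasDerivAt (fun t => H (Γ t)) (fderiv ℝ H (Γ 0) (f (Γ 0))) 0 :=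
    (differentiableAt_of_contDiffOn hX hH (h0 ▸ hx)).hasFDerivAt.comp_hasDerivAt 0
      (hΓ.1.hasDerivAt 0 hΓ.1.zero_mem)
  rw [h0] at hderiv
  refine hderiv.unique ((hasDerivAt_const (0 : ℝ) (H x)).congr_of_eventuallyEq ?_)
  filter_upwards [hΓ.1.isOpen.mem_nhds hΓ.1.zero_mem] with t ht
    using hfirst.2 x hx K Γ hΓ t ht

theorem IsSolution.eq_of_fderiv_apply_eq_zero (hX : IsOpen X) (hH : ContDiffOn ℝ 1 H X)
    (hinv : ∀ x ∈ X, fderiv ℝ H x (f x) = 0) (h : IsSolution f X x J γ) (ht : t ∈ J) :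
    H (γ t) = H x := by
  have hderiv : ∀ s ∈ J, HasDerivAt (fun s => H (γ s)) 0 s := fun s hs =>
    hasDerivAt_comp_of_fderiv_apply_eq_zero hX hH hinv (h.mem s hs) (h.hasDerivAt s hs)
  have := h.isOpen.is_const_of_deriv_eq_zero h.ordConnected.isPreconnected
    (fun s hs => (hderiv s hs).differentiableAt.differentiableWithinAt)
    (fun s hs => (hderiv s hs).deriv) ht h.zero_mem
  simpa only [h.initial] using this

/-! ### The weighted speed -/

/-- The Jacobian of `f` with its rows weighted by the gradient of `H`. It gives the rates at which
the coordinates exchange the quantity `∂H/∂x^i * f^i` along the solutions. -/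
noncomputable def fluxMatrix (f : EuclideanSpace ℝ (Fin n) → EuclideanSpace ℝ (Fin n))
    (H : EuclideanSpace ℝ (Fin n) → ℝ) (x : EuclideanSpace ℝ (Fin n)) :
    Matrix (Fin n) (Fin n) ℝ :=
  Matrix.of fun i j => gradient H x i * jacobian f x i j

/-- The `ℓ¹` norm of the velocity `f x`, weighted by the gradient of `H`: the Lyapunov function
that does not increase along the solutions. -/
noncomputable def weightedSpeed (f : EuclideanSpace ℝ (Fin n) → EuclideanSpace ℝ (Fin n))
    (H : EuclideanSpace ℝ (Fin n) → ℝ) (x : EuclideanSpace ℝ (Fin n)) : ℝ :=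
  ∑ i, |gradient H x i * f x i|

theorem fluxMatrix_nonneg (hcoop : IsCooperative f X) (hgrad : HasPositiveGradient X H)
    (hx : x ∈ X) (i j : Fin n) (hij : i ≠ j) : 0 ≤ fluxMatrix f H x i j :=
  mul_nonneg (hgrad x hx i).le (hcoop x hx i j hij)

theorem matrixIrreducible_fluxMatrix (hirr : MatrixIrreducible (jacobian f x))
    (hgrad : ∀ i, 0 < gradient H x i) : MatrixIrreducible (fluxMatrix f H x) := fun S hS hS' => by
  obtain ⟨i, hi, j, hj, hij⟩ := hirr S hS hS'
  exact ⟨i, hi, j, hj, mul_ne_zero (hgrad i).ne' hij⟩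

theorem weightedSpeed_nonneg (f : EuclideanSpace ℝ (Fin n) → EuclideanSpace ℝ (Fin n))
    (H : EuclideanSpace ℝ (Fin n) → ℝ) (x : EuclideanSpace ℝ (Fin n)) : 0 ≤ weightedSpeed f H x :=
  Finset.sum_nonneg fun _ _ => abs_nonneg _

theorem weightedSpeed_eq_zero_iff (hgrad : ∀ i, 0 < gradient H x i) :
    weightedSpeed f H x = 0 ↔ f x = 0 := by
  rw [weightedSpeed, Finset.sum_eq_zero_iff_of_nonneg fun _ _ => abs_nonneg _, PiLp.ext_iff]
  simp [(hgrad _).ne']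

theorem continuousOn_weightedSpeed (hX : IsOpen X) (hf : ContinuousOn f X)
    (hH : ContDiffOn ℝ 1 H X) : ContinuousOn (weightedSpeed f H) X :=
  continuousOn_finsetSum _ fun i _ => ((continuousOn_gradient_apply hX hH i).mul
    ((EuclideanSpace.proj i).continuous.comp_continuousOn hf)).abs

theorem IsSolution.hasDerivAt_gradient_mul (hX : IsOpen X) (hf : ContDiffOn ℝ 1 f X)
    (hH : ContDiffOn ℝ 1 H X) (hinv : ∀ x ∈ X, fderiv ℝ H x (f x) = 0)
    (h : IsSolution f X x J γ) (ht : t ∈ J) (i : Fin n) :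
    HasDerivAt (fun s => gradient H (γ s) i * f (γ s) i)
      (netFlux (fluxMatrix f H (γ t)) (f (γ t)) i) t := by
  have hγX := h.mem t ht
  have hdf := differentiableAt_of_contDiffOn hX hf hγX
  have hgrad := hasDerivAt_fderiv_apply_of_fderiv_apply_eq_zero hX hf hH hinv hγX
    (by filter_upwards [h.isOpen.mem_nhds ht] with s hs using h.hasDerivAt s hs)
    (EuclideanSpace.single i 1)
  have hvel : HasDerivAt (fun s => f (γ s) i) (fderiv ℝ f (γ t) (f (γ t)) i) t :=
    (EuclideanSpace.proj i : EuclideanSpace ℝ (Fin n) →L[ℝ] ℝ).hasFDerivAt.comp_hasDerivAt t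
      (hdf.hasFDerivAt.comp_hasDerivAt t (h.hasDerivAt t ht))
  simp only [← gradient_apply] at hgrad
  simp only [fderiv_apply_eq_sum_gradient_mul, ← jacobian_apply hdf] at hgrad
  refine (hgrad.mul hvel).congr_deriv ?_
  simp only [fderiv_apply_eq_sum_jacobian_mul hdf, netFlux, fluxMatrix, Matrix.of_apply,
    Finset.sum_sub_distrib, Finset.mul_sum, Finset.sum_mul, neg_mul, mul_assoc]
  ring

theorem IsSolution.antitoneOn_weightedSpeed (hX : IsOpen X) (hf : ContDiffOn ℝ 1 f X)
    (hcoop : IsCooperative f X) (hH : ContDiffOn ℝ 1 H X)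
    (hinv : ∀ x ∈ X, fderiv ℝ H x (f x) = 0) (hgrad : HasPositiveGradient X H)
    (h : IsSolution f X x J γ) : AntitoneOn (fun t => weightedSpeed f H (γ t)) J := by
  refine antitoneOn_of_right_deriv_nonpos h.ordConnected
    ((continuousOn_weightedSpeed hX hf.continuousOn hH).comp h.continuousOn h.mem) fun t ht => ?_
  have hγX := h.mem t ht
  choose σ hσ₁ hσ hderiv using fun i => exists_hasDerivWithinAt_abs
    (h.hasDerivAt_gradient_mul hX hf hH hinv ht i).hasDerivWithinAt
  refine ⟨_, sum_mul_netFlux_nonpos (fluxMatrix_nonneg hcoop hgrad hγX) (fun i => (hσ₁ i).le)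
    fun i => ?_, HasDerivWithinAt.fun_sum fun i _ => hderiv i⟩
  have hpos := hgrad _ hγX i
  refine mul_left_cancel₀ hpos.ne' ?_
  rw [mul_left_comm, hσ, abs_mul, abs_of_pos hpos]

-- Where `w i = 0` the two one-sided derivatives of `|w i|` are opposite, so they cancel in the
-- symmetric derivative and leave the sign `0` that the strict inequality needs.
theorem IsSolution.apply_eq_zero_of_weightedSpeed_eq (hX : IsOpen X) (hf : ContDiffOn ℝ 1 f X)
    (hcoop : IsCooperativeIrreducible f X) (hH : ContDiffOn ℝ 1 H X)
    (hinv : ∀ x ∈ X, fderiv ℝ H x (f x) = 0) (hgrad : HasPositiveGradient X H)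
    (h : IsSolution f X x J γ) (hconst : ∀ᶠ t in 𝓝 0, weightedSpeed f H (γ t) = c) : f x = 0 := by
  by_contra hfx
  have hxX : x ∈ X := h.initial ▸ h.mem 0 h.zero_mem
  have hsym := HasDerivAt.fun_sum (u := Finset.univ) fun i _ => hasDerivAt_abs_add_sub_abs_sub
    (h.hasDerivAt_gradient_mul hX hf hH hinv h.zero_mem i)
  simp only [Finset.sum_sub_distrib, zero_add, zero_sub, h.initial, ← Finset.mul_sum, sign_mul,
    sign_pos (hgrad x hxX _), one_mul] at hsym
  have hzero : HasDerivAt (fun s => weightedSpeed f H (γ s) - weightedSpeed f H (γ (-s))) 0 0 := by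
    refine (hasDerivAt_const (0 : ℝ) (0 : ℝ)).congr_of_eventuallyEq ?_
    have hneg : Tendsto (fun s : ℝ => -s) (𝓝 0) (𝓝 0) := by simpa using tendsto_neg (0 : ℝ)
    filter_upwards [hconst, hneg.eventually hconst] with s hs hs'
    rw [hs, hs', sub_self]
  obtain ⟨hlt, hgt⟩ := exists_neg_and_exists_pos_of_sum_mul_eq_zero (hgrad x hxX)
    ((fderiv_apply_eq_sum_gradient_mul H x (f x)).symm.trans (hinv x hxX))
    (v := f x) fun h0 => hfx (PiLp.ext (congrFun h0))
  have hflux := sum_sign_mul_netFlux_neg (fluxMatrix_nonneg hcoop.1 hgrad hxX)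
    (matrixIrreducible_fluxMatrix (hcoop.2 x hxX) (hgrad x hxX)) hlt hgt
  linarith [hsym.unique hzero]

theorem IsSolution.apply_eq_zero_of_tendsto (hX : IsOpen X) (hf : ContDiffOn ℝ 1 f X)
    (hcoop : IsCooperativeIrreducible f X) (hH : ContDiffOn ℝ 1 H X)
    (hinv : ∀ x ∈ X, fderiv ℝ H x (f x) = 0) (hgrad : HasPositiveGradient X H)
    (h : IsSolution f X x J γ) (hy : y ∈ X) {l : Filter ℝ} (hl : ∀ s, Tendsto (s + ·) l l)
    (hJ : ∀ᶠ t in l, t ∈ J) (hspeed : Tendsto (fun t => weightedSpeed f H (γ t)) l (𝓝 c))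
    {τ : ℕ → ℝ} (hτJ : ∀ k, τ k ∈ J) (hτ : Tendsto τ atTop l)
    (hlim : Tendsto (fun k => γ (τ k)) atTop (𝓝 y)) : f y = 0 := by
  obtain ⟨δ, hδ, β, hβ, hβlim⟩ := h.exists_tendsto_add hX hf hy hτJ hlim
  refine hβ.apply_eq_zero_of_weightedSpeed_eq hX hf hcoop hH hinv hgrad (c := c) ?_
  filter_upwards [Ioo_mem_nhds (neg_lt_zero.2 hδ) hδ] with s hs
  have hsτ : Tendsto (fun k => s + τ k) atTop l := (hl s).comp hτ
  have hcont := (continuousOn_weightedSpeed hX hf.continuousOn hH).continuousAt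
    (hX.mem_nhds (hβ.mem s hs))
  exact tendsto_nhds_unique (hcont.tendsto.comp (hβlim s hs (hsτ.eventually hJ)))
    (hspeed.comp hsτ)

theorem IsSolution.apply_eq_zero_of_tendsto_atTop (hX : IsOpen X) (hf : ContDiffOn ℝ 1 f X)
    (hcoop : IsCooperativeIrreducible f X) (hH : ContDiffOn ℝ 1 H X)
    (hinv : ∀ x ∈ X, fderiv ℝ H x (f x) = 0) (hgrad : HasPositiveGradient X H)
    (h : IsSolution f X x J γ) (hy : y ∈ X) {τ : ℕ → ℝ} (hτJ : ∀ k, τ k ∈ J)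
    (hτ : Tendsto τ atTop atTop) (hlim : Tendsto (fun k => γ (τ k)) atTop (𝓝 y)) : f y = 0 := by
  have hspeed := ((continuousOn_weightedSpeed hX hf.continuousOn hH).continuousAt
    (hX.mem_nhds hy)).tendsto.comp hlim
  exact h.apply_eq_zero_of_tendsto hX hf hcoop hH hinv hgrad hy
    (fun s => tendsto_atTop_add_const_left _ s tendsto_id)
    (eventually_atTop_mem_of_tendsto h.ordConnected hτJ hτ)
    (tendsto_atTop_of_antitoneOn h.ordConnected
      (h.antitoneOn_weightedSpeed hX hf hcoop.1 hH hinv hgrad) hτJ hτ hspeed) hτJ hτ hlim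

theorem IsSolution.apply_eq_zero_of_tendsto_atBot (hX : IsOpen X) (hf : ContDiffOn ℝ 1 f X)
    (hcoop : IsCooperativeIrreducible f X) (hH : ContDiffOn ℝ 1 H X)
    (hinv : ∀ x ∈ X, fderiv ℝ H x (f x) = 0) (hgrad : HasPositiveGradient X H)
    (h : IsSolution f X x J γ) (hy : y ∈ X) {τ : ℕ → ℝ} (hτJ : ∀ k, τ k ∈ J)
    (hτ : Tendsto τ atTop atBot) (hlim : Tendsto (fun k => γ (τ k)) atTop (𝓝 y)) : f x = 0 := by
  have hxX : x ∈ X := h.initial ▸ h.mem 0 h.zero_mem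
  have hspeed := ((continuousOn_weightedSpeed hX hf.continuousOn hH).continuousAt
    (hX.mem_nhds hy)).tendsto.comp hlim
  have hanti := h.antitoneOn_weightedSpeed hX hf hcoop.1 hH hinv hgrad
  have hfy : f y = 0 := h.apply_eq_zero_of_tendsto hX hf hcoop hH hinv hgrad hy
    (fun s => tendsto_atBot_add_const_left _ s tendsto_id)
    (eventually_atBot_mem_of_tendsto h.ordConnected hτJ hτ)
    (tendsto_atBot_of_antitoneOn h.ordConnected hanti hτJ hτ hspeed) hτJ hτ hlim
  have hle : weightedSpeed f H x ≤ weightedSpeed f H y := by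
    refine ge_of_tendsto hspeed ?_
    filter_upwards [hτ.eventually_le_atBot 0] with k hk
    simpa only [h.initial, Function.comp_apply] using hanti (hτJ k) h.zero_mem hk
  rw [(weightedSpeed_eq_zero_iff (hgrad y hy)).2 hfy] at hle
  exact (weightedSpeed_eq_zero_iff (hgrad x hxX)).1 (hle.antisymm (weightedSpeed_nonneg f H x))

/-! ### Comparison with an equilibrium -/

theorem IsCooperative.apply_le_apply (hX : IsOpen X) (hf : ContDiffOn ℝ 1 f X)
    (hcoop : IsCooperative f X) (hK : Convex ℝ K) (hKX : K ⊆ X) (hx : x ∈ K) (hy : y ∈ K)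
    (hxy : ∀ j, x j ≤ y j) {i : Fin n} (hi : x i = y i) : f x i ≤ f y i := by
  have hderiv : ∀ z ∈ K, HasFDerivWithinAt (fun z => f z i)
      ((EuclideanSpace.proj i : EuclideanSpace ℝ (Fin n) →L[ℝ] ℝ).comp (fderiv ℝ f z)) K z :=
    fun z hz => ((EuclideanSpace.proj i : EuclideanSpace ℝ (Fin n) →L[ℝ] ℝ).hasFDerivAt.comp z
      (differentiableAt_of_contDiffOn hX hf (hKX hz)).hasFDerivAt).hasFDerivWithinAt
  obtain ⟨z, hz, hmvt⟩ := domain_mvt hderiv hK hx hy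
  have hzX : z ∈ X := hKX (hK.segment_subset hx hy hz)
  rw [← sub_nonneg, hmvt]
  change 0 ≤ fderiv ℝ f z (y - x) i
  rw [fderiv_apply_eq_sum_jacobian_mul (differentiableAt_of_contDiffOn hX hf hzX)]
  refine Finset.sum_nonneg fun j _ => ?_
  rcases eq_or_ne i j with rfl | hij
  · simp [hi]
  · exact mul_nonneg (hcoop z hzX i j hij) (sub_nonneg.2 (hxy j))

theorem HasPositiveGradient.lt_of_le_of_ne (hX : IsOpen X) (hH : ContDiffOn ℝ 1 H X)
    (hgrad : HasPositiveGradient X H) (hK : Convex ℝ K) (hKX : K ⊆ X) (hx : x ∈ K) (hy : y ∈ K)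
    (hxy : ∀ i, x i ≤ y i) (hne : x ≠ y) : H x < H y := by
  obtain ⟨z, hz, hmvt⟩ := domain_mvt (fun z hz =>
    (differentiableAt_of_contDiffOn hX hH (hKX hz)).hasFDerivAt.hasFDerivWithinAt) hK hx hy
  have hpos := hgrad z (hKX (hK.segment_subset hx hy hz))
  obtain ⟨i, hi⟩ : ∃ i, x i ≠ y i := by
    by_contra! h
    exact hne (PiLp.ext h)
  rw [← sub_pos, hmvt, fderiv_apply_eq_sum_gradient_mul]
  exact Finset.sum_pos' (fun j _ => mul_nonneg (hpos j).le (sub_nonneg.2 (hxy j)))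
    ⟨i, Finset.mem_univ i, mul_pos (hpos i) (sub_pos.2 ((hxy i).lt_of_ne hi))⟩

theorem HasPositiveGradient.le_of_le (hX : IsOpen X) (hH : ContDiffOn ℝ 1 H X)
    (hgrad : HasPositiveGradient X H) (hK : Convex ℝ K) (hKX : K ⊆ X) (hx : x ∈ K) (hy : y ∈ K)
    (hxy : ∀ i, x i ≤ y i) : H x ≤ H y := by
  rcases eq_or_ne x y with rfl | hne
  · rfl
  · exact (hgrad.lt_of_le_of_ne hX hH hK hKX hx hy hxy hne).le

/-- The coordinatewise supremum of `x` and `p`, written out because `EuclideanSpace` carries no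
order. -/
noncomputable def coordSup (x p : EuclideanSpace ℝ (Fin n)) : EuclideanSpace ℝ (Fin n) :=
  WithLp.toLp 2 fun i => max (x i) (p i)

theorem coordSup_apply (x p : EuclideanSpace ℝ (Fin n)) (i : Fin n) :
    coordSup x p i = max (x i) (p i) := rfl

theorem continuous_coordSup (p : EuclideanSpace ℝ (Fin n)) : Continuous (coordSup · p) := by
  unfold coordSup
  fun_prop

theorem dist_coordSup_le (x p : EuclideanSpace ℝ (Fin n)) : dist (coordSup x p) p ≤ dist x p := by
  rw [EuclideanSpace.dist_eq, EuclideanSpace.dist_eq]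
  refine Real.sqrt_le_sqrt (Finset.sum_le_sum fun i _ => ?_)
  gcongr
  simpa [Real.dist_eq, coordSup_apply] using abs_max_sub_max_le_abs (x i) (p i) (p i)

theorem IsSolution.exists_hasDerivWithinAt_coordSup (hX : IsOpen X) (hf : ContDiffOn ℝ 1 f X)
    (hcoop : IsCooperative f X) (hfp : f p = 0) (hball : Metric.closedBall p r ⊆ X)
    (h : IsSolution f X x J γ) (ht : t ∈ J) (hr : γ t ∈ Metric.closedBall p r) :
    ∃ d, HasDerivWithinAt (fun s => coordSup (γ s) p) d (Ici t) t ∧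
      ∀ i, d i ≤ f (coordSup (γ t) p) i := by
  have hsup : coordSup (γ t) p ∈ Metric.closedBall p r := (dist_coordSup_le _ _).trans hr
  have hp : p ∈ Metric.closedBall p r := Metric.mem_closedBall_self (dist_nonneg.trans hr)
  have hconv := convex_closedBall p r
  have hγ : ∀ i, HasDerivWithinAt (fun s => γ s i) (f (γ t) i) (Ici t) t := fun i =>
    ((EuclideanSpace.proj i : EuclideanSpace ℝ (Fin n) →L[ℝ] ℝ).hasFDerivAt.comp_hasDerivAt t
      (h.hasDerivAt t ht)).hasDerivWithinAt
  choose d hd hdi using fun i =>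
    exists_hasDerivWithinAt_max (hγ i) (hasDerivWithinAt_const t (Ici t) (p i))
  refine ⟨WithLp.toLp 2 d, ?_, fun i => ?_⟩
  · exact (EuclideanSpace.equiv (Fin n) ℝ).symm.hasFDerivAt.comp_hasDerivWithinAt t
      (hasDerivWithinAt_pi.2 hd)
  rcases hdi i with ⟨hi, hle⟩ | ⟨hi, hle⟩
  · refine hi.trans_le (hcoop.apply_le_apply hX hf hconv hball hr hsup
      (fun j => le_max_left _ _) (max_eq_left hle).symm)
  · refine hi.trans_le ?_
    have := hcoop.apply_le_apply hX hf hconv hball hp hsup (i := i)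
      (fun j => le_max_right _ _) (max_eq_right hle).symm
    simpa [hfp] using this

theorem IsSolution.antitoneOn_coordSup (hX : IsOpen X) (hf : ContDiffOn ℝ 1 f X)
    (hcoop : IsCooperative f X) (hH : ContDiffOn ℝ 1 H X)
    (hinv : ∀ x ∈ X, fderiv ℝ H x (f x) = 0) (hgrad : HasPositiveGradient X H) (hfp : f p = 0)
    (hball : Metric.closedBall p r ⊆ X) (h : IsSolution f X x J γ) {S : Set ℝ}
    (hS : S.OrdConnected) (hSJ : S ⊆ J) (hr : MapsTo γ S (Metric.closedBall p r)) :
    AntitoneOn (fun t => H (coordSup (γ t) p)) S := by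
  have hsup : ∀ t ∈ S, coordSup (γ t) p ∈ X := fun t ht =>
    hball ((dist_coordSup_le _ _).trans (hr ht))
  refine antitoneOn_of_right_deriv_nonpos hS (hH.continuousOn.comp
    ((continuous_coordSup p).comp_continuousOn (h.continuousOn.mono hSJ)) hsup) fun t ht => ?_
  obtain ⟨d, hd, hdf⟩ :=
    h.exists_hasDerivWithinAt_coordSup hX hf hcoop hfp hball (hSJ ht) (hr ht)
  refine ⟨_, ?_, (differentiableAt_of_contDiffOn hX hH
    (hsup t ht)).hasFDerivAt.comp_hasDerivWithinAt t hd⟩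
  calc fderiv ℝ H (coordSup (γ t) p) d
      ≤ fderiv ℝ H (coordSup (γ t) p) (f (coordSup (γ t) p)) := by
        simp only [fderiv_apply_eq_sum_gradient_mul]
        exact Finset.sum_le_sum fun i _ =>
          mul_le_mul_of_nonneg_left (hdf i) (hgrad _ (hsup t ht) i).le
    _ = 0 := hinv _ (hsup t ht)

/-! ### Lyapunov stability of equilibria -/

/-- Lyapunov stability of `p`: the solutions that start near `p` stay near `p` in forward time. -/
def IsLyapunovStable (f : EuclideanSpace ℝ (Fin n) → EuclideanSpace ℝ (Fin n))
    (X : Set (EuclideanSpace ℝ (Fin n))) (p : EuclideanSpace ℝ (Fin n)) : Prop :=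
  ∀ U ∈ 𝓝 p, ∀ᶠ x in 𝓝 p, ∀ J γ, IsSolution f X x J γ → ∀ t ∈ J, 0 ≤ t → γ t ∈ U

/-- The Lyapunov function `(H (y ⊔ p) - H y) + (H (y ⊔ p) - H p)` of the stability argument. -/
noncomputable def supDefect (H : EuclideanSpace ℝ (Fin n) → ℝ)
    (p y : EuclideanSpace ℝ (Fin n)) : ℝ :=
  (H (coordSup y p) - H y) + (H (coordSup y p) - H p)

theorem supDefect_self (H : EuclideanSpace ℝ (Fin n) → ℝ) (p : EuclideanSpace ℝ (Fin n)) :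
    supDefect H p p = 0 := by
  have hsup : coordSup p p = p := PiLp.ext fun i => max_self (p i)
  simp [supDefect, hsup]

theorem supDefect_pos (hX : IsOpen X) (hH : ContDiffOn ℝ 1 H X) (hgrad : HasPositiveGradient X H)
    (hball : Metric.closedBall p r ⊆ X) (hy : y ∈ Metric.closedBall p r) (hne : y ≠ p) :
    0 < supDefect H p y := by
  have hsup : coordSup y p ∈ Metric.closedBall p r := (dist_coordSup_le _ _).trans hy
  have hp : p ∈ Metric.closedBall p r := Metric.mem_closedBall_self (dist_nonneg.trans hy)
  have hconv := convex_closedBall p r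
  have hle_y := hgrad.le_of_le hX hH hconv hball hy hsup fun i => le_max_left _ _
  have hle_p := hgrad.le_of_le hX hH hconv hball hp hsup fun i => le_max_right _ _
  rcases eq_or_ne y (coordSup y p) with heq | hne'
  · have hlt := hgrad.lt_of_le_of_ne hX hH hconv hball hp hsup (fun i => le_max_right _ _)
      fun h => hne (heq.trans h.symm)
    exact add_pos_of_nonneg_of_pos (sub_nonneg.2 hle_y) (sub_pos.2 hlt)
  · have hlt := hgrad.lt_of_le_of_ne hX hH hconv hball hy hsup (fun i => le_max_left _ _) hne'
    exact add_pos_of_pos_of_nonneg (sub_pos.2 hlt) (sub_nonneg.2 hle_p)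

theorem continuousOn_supDefect (hH : ContinuousOn H X) (hball : Metric.closedBall p r ⊆ X) :
    ContinuousOn (supDefect H p) (Metric.closedBall p r) := by
  have hsup : ContinuousOn (fun y => H (coordSup y p)) (Metric.closedBall p r) :=
    hH.comp (continuous_coordSup p).continuousOn fun y hy =>
      hball ((dist_coordSup_le y p).trans hy)
  exact (hsup.sub (hH.mono hball)).add (hsup.sub continuousOn_const)

theorem IsCooperative.isLyapunovStable (hX : IsOpen X) (hf : ContDiffOn ℝ 1 f X)
    (hcoop : IsCooperative f X) (hH : ContDiffOn ℝ 1 H X)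
    (hinv : ∀ x ∈ X, fderiv ℝ H x (f x) = 0) (hgrad : HasPositiveGradient X H) (hp : p ∈ X)
    (hfp : f p = 0) : IsLyapunovStable f X p := by
  intro U hU
  obtain ⟨r, hr, hrU⟩ := Metric.nhds_basis_closedBall.mem_iff.1 (inter_mem hU (hX.mem_nhds hp))
  have hball : Metric.closedBall p r ⊆ X := fun z hz => (hrU hz).2
  have hcont := continuousOn_supDefect hH.continuousOn hball
  obtain ⟨m, hm, hsphere⟩ := (isCompact_sphere p r).exists_forall_le'
    (hcont.mono Metric.sphere_subset_closedBall) (a := 0) fun z hz =>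
      supDefect_pos hX hH hgrad hball (Metric.sphere_subset_closedBall hz)
        (Metric.ne_of_mem_sphere hz hr.ne')
  have hlt : ∀ᶠ x in 𝓝 p, supDefect H p x < m :=
    (hcont.continuousAt (Metric.closedBall_mem_nhds p hr)).eventually_lt_const
      (by rwa [supDefect_self])
  filter_upwards [hlt, Metric.ball_mem_nhds p hr] with x hxm hxr J γ h t ht ht0
  by_contra hγU
  have hJ : Icc 0 t ⊆ J := h.ordConnected.out h.zero_mem ht
  obtain ⟨c, hc, hcr, hstay⟩ := exists_eq_and_forall_le_of_lt_of_le (r := r) ht0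
    (Continuous.comp_continuousOn (g := fun z => dist z p) (by fun_prop)
      (h.continuousOn.mono hJ))
    (by simpa [h.initial] using hxr) (le_of_not_ge fun hle => hγU (hrU hle).1)
  have hcJ : Icc 0 c ⊆ J := (Icc_subset_Icc_right hc.2).trans hJ
  have hanti := h.antitoneOn_coordSup hX hf hcoop hH hinv hgrad hfp hball ordConnected_Icc hcJ
    hstay (left_mem_Icc.2 hc.1) (right_mem_Icc.2 hc.1) hc.1
  have hHc := h.eq_of_fderiv_apply_eq_zero hX hH hinv (hcJ (right_mem_Icc.2 hc.1))
  have hmc : m ≤ supDefect H p (γ c) := hsphere _ hcr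
  simp only [h.initial] at hanti
  simp only [supDefect, hHc] at hmc hxm
  linarith

theorem IsLyapunovStable.tendsto (hp : IsLyapunovStable f X p) (h : IsSolution f X x J γ)
    {τ σ : ℕ → ℝ} (hτJ : ∀ k, τ k ∈ J) (hτ : Tendsto (fun k => γ (τ k)) atTop (𝓝 p))
    (hσJ : ∀ k, σ k ∈ J) (hσ : Tendsto σ atTop atTop) :
    Tendsto (fun k => γ (σ k)) atTop (𝓝 p) := by
  refine tendsto_def.2 fun U hU => ?_
  obtain ⟨k, hk⟩ := (hτ.eventually (hp U hU)).exists
  filter_upwards [hσ.eventually_ge_atTop (τ k)] with m hm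
  simpa using hk _ _ (h.shift (hτJ k)) (σ m - τ k) (by simpa using hσJ m) (sub_nonneg.2 hm)

/-! ### Limit sets -/

theorem subsingleton_omegaLimitSet (hX : IsOpen X) (hf : ContDiffOn ℝ 1 f X)
    (hcoop : IsCooperativeIrreducible f X) (hH : ContDiffOn ℝ 1 H X)
    (hinv : ∀ x ∈ X, fderiv ℝ H x (f x) = 0) (hgrad : HasPositiveGradient X H) :
    (omegaLimitSet f X x).Subsingleton := by
  rintro p ⟨hpX, J, γ, hγ, τ, hτJ, hτ, hτp⟩ y ⟨-, J', γ', hγ', σ, hσJ, hσ, hσy⟩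
  obtain ⟨rfl, heq⟩ := hγ.unique hX hf hγ'
  have hfp : f p = 0 := hγ.1.apply_eq_zero_of_tendsto_atTop hX hf hcoop hH hinv hgrad hpX hτJ hτ hτp
  have hσp := (hcoop.1.isLyapunovStable hX hf hH hinv hgrad hpX hfp).tendsto hγ.1 hτJ hτp hσJ hσ
  exact tendsto_nhds_unique hσp (hσy.congr fun k => (heq (hσJ k)).symm)

theorem isEquilibrium_of_mem_alphaLimitSet (hX : IsOpen X) (hf : ContDiffOn ℝ 1 f X)
    (hcoop : IsCooperativeIrreducible f X) (hH : ContDiffOn ℝ 1 H X)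
    (hinv : ∀ x ∈ X, fderiv ℝ H x (f x) = 0) (hgrad : HasPositiveGradient X H)
    (hy : y ∈ alphaLimitSet f X x) : IsEquilibrium f X x := by
  obtain ⟨hyX, J, γ, hγ, τ, hτJ, hτ, hlim⟩ := hy
  exact (isEquilibrium_iff f X x).2 ⟨hγ.1.initial ▸ hγ.1.mem 0 hγ.1.zero_mem,
    hγ.1.apply_eq_zero_of_tendsto_atBot hX hf hcoop hH hinv hgrad hyX hτJ hτ hlim⟩

end VectorField

end CooperativeODE

theorem theorem8 {n : ℕ} (X : Set (EuclideanSpace ℝ (Fin n))) (hX : IsOpen X)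
    (f : EuclideanSpace ℝ (Fin n) → EuclideanSpace ℝ (Fin n)) (hf : ContDiffOn ℝ 1 f X)
    (hcoop : CooperativeODE.IsCooperativeIrreducible f X)
    (H : EuclideanSpace ℝ (Fin n) → ℝ) (hH : ContDiffOn ℝ 1 H X)
    (hfirst : CooperativeODE.IsFirstIntegral f X H)
    (hgrad : CooperativeODE.HasPositiveGradient X H) :
    (∀ x ∈ X, CooperativeODE.omegaLimitSet f X x = ∅ ∨
      ∃ y, CooperativeODE.omegaLimitSet f X x = {y}) ∧
    (∀ x ∈ X, (CooperativeODE.alphaLimitSet f X x).Nonempty →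
      CooperativeODE.IsEquilibrium f X x) := by
  have hinv : ∀ x ∈ X, fderiv ℝ H x (f x) = 0 := fun x hx =>
    hfirst.fderiv_apply_eq_zero hX hf hH hx
  exact ⟨fun x _ => (CooperativeODE.subsingleton_omegaLimitSet hX hf hcoop hH hinv
      hgrad).eq_empty_or_singleton,
    fun x _ ⟨_, hy⟩ =>
      CooperativeODE.isEquilibrium_of_mem_alphaLimitSet hX hf hcoop hH hinv hgrad hy⟩
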